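/- There are absolute constants $c_1,c_2>0$ such that the following holds. Let $d\ge 1$, $K\ge 2$, $\alpha\ge 0$, $x_{\max}>0$, and let $A_1,A_2$ be real numbers such that $\mathcal L(x)=A_1+A_2x^{\alpha}$ is non-decreasing on $[0,\infty)$. Let $\mathbf X=(X_1^\top,\dots,X_K^\top)$ be the contexts of one round, a random vector in $\mathbb R^{dK}$ ($X_i\in\mathbb R^d$ is the context of arm $i$; the arms may be dependent) with an everywhere positive density $f$ such that $\log f$ is differentiable on $\mathbb R^{dK}$ and $$\|\nabla\log f(x)\|_\infty\le \mathcal L(\|x\|_\infty)\qquad\text{for all }x\in\mathbb R^{dK}$$ (the local anti-concentration (LAC) condition with LAC function $\mathcal L$), and suppose that $\|X_i\|_{\psi_1}\le x_{\max}$ for every $i$, where $\|Y\|_{\psi_1}=\sup_{\|u\|_2=1}\sup_{p\ge1}p^{-1}\big(\mathbb E|\langle u,Y\rangle|^p\big)^{1/p}$ for a random vector $Y$ in $\mathbb R^d$. Put $R_1=c_2x_{\max}(\log d+\log K+2)$ and $$\lambda=\frac{c_1}{d}\cdot\frac{1}{\big(A_1+A_2(R_1+2)^{\alpha}\big)^2}.$$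 (a) For every $\theta\in\mathbb R^d\setminus\{0\}$ and every greedy arm $a\in\arg\max_{i}X_i^\top\theta$ one has $\mathbb E[X_aX_a^\top]\succeq\lambda I_d$. (b) For every history ($\sigma$-algebra) $\mathcal H$ that is independent of $\mathbf X$, every $\mathcal H$-measurable estimator $\hat\theta$ with $\hat\theta\ne0$ almost surely, and every greedy arm $a\in\arg\max_iX_i^\top\hat\theta$, one has $\mathbb E[X_aX_a^\top\mid\mathcal H]\succeq\lambda I_d$ almost surely. In particular the diversity constant is $\Omega(1/d)$ up to logarithmic factors: for all $A_1,A_2,\alpha,x_{\max}$ there is $c>0$, depending on these four numbers only, such that (a) and (b) hold for all $d$, $K$ and $\mathbf X$ as above with $\lambda$ replaced by $\dfrac{c}{d\,(\log d+\log K+2)^{2\alpha}}$. -/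

import Mathlib

open MeasureTheory ProbabilityTheory
open scoped ENNReal

universe u

/-- The local anti-concentration (LAC) condition with LAC function `L`, for a density `f` on `ℝ^ι`
with full support: `L` is non-decreasing on `[0, ∞)`, `log f` is defined and differentiable
everywhere, and `‖∇ log f(x)‖_∞ ≤ L(‖x‖_∞)` for all `x`. The norm of `ι → ℝ` is the sup norm, and
the directional derivative along `Pi.single k 1` is the `k`-th partial derivative. -/
structure IsLAC {ι : Type*} [Fintype ι] [DecidableEq ι] (f : (ι → ℝ) → ℝ) (L : ℝ → ℝ) : Prop where
  mono : MonotoneOn L (Set.Ici 0)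
  pos : ∀ x, 0 < f x
  diff : ∀ x, DifferentiableAt ℝ (fun y => Real.log (f y)) x
  bound : ∀ x, ∀ k : ι, |fderiv ℝ (fun y => Real.log (f y)) x (Pi.single k 1)| ≤ L ‖x‖

/-- `‖Y‖_{ψ₁} = sup_{p ≥ 1} p⁻¹ (E |Y|^p)^{1/p}` for a real random variable `Y`. -/
noncomputable def psiOneNorm {Ω : Type*} [MeasurableSpace Ω] (μ : Measure Ω) (Y : Ω → ℝ) : ℝ≥0∞ :=
  ⨆ (p : ℝ) (_ : 1 ≤ p),
    ENNReal.ofReal p⁻¹ * (∫⁻ ω, ENNReal.ofReal (|Y ω| ^ p) ∂μ) ^ (1 / p)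

/-- `‖Y‖_{ψ₁} = sup_{‖u‖₂ = 1} ‖⟨u, Y⟩‖_{ψ₁}` for a random vector `Y` in `ℝ^d`. -/
noncomputable def psiOneNormVec {Ω : Type*} [MeasurableSpace Ω] {d : ℕ} (μ : Measure Ω)
    (Y : Ω → Fin d → ℝ) : ℝ≥0∞ :=
  ⨆ (u : Fin d → ℝ) (_ : u ⬝ᵥ u = 1), psiOneNorm μ (fun ω => u ⬝ᵥ Y ω)

/-- The context vector `x_i ∈ ℝ^d` of arm `i` inside the stacked vector `x ∈ ℝ^{dK}`. -/
def armContext {K d : ℕ} (x : Fin K × Fin d → ℝ) (i : Fin K) : Fin d → ℝ := fun j => x (i, j)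

/-- The stacked contexts `X` of one round are unbounded contexts with LAC function `L` and with
`ψ₁` norms at most `xmax`. -/
structure IsUnboundedContexts {Ω : Type*} [MeasurableSpace Ω] {K d : ℕ} (μ : Measure Ω)
    (X : Ω → Fin K × Fin d → ℝ) (L : ℝ → ℝ) (xmax : ℝ) : Prop where
  measurable : Measurable X
  density : ∃ f : (Fin K × Fin d → ℝ) → ℝ, IsLAC f L ∧
    μ.map X = (volume : Measure (Fin K × Fin d → ℝ)).withDensity (fun x => ENNReal.ofReal (f x))
  psi_le : ∀ i, psiOneNormVec μ (fun ω => armContext (X ω) i) ≤ ENNReal.ofReal xmax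

/-- The arm `a` is measurable and almost surely maximizes `X_iᵀ θ`, for the (possibly random)
direction `θ`. -/
def IsGreedy {Ω : Type*} [MeasurableSpace Ω] {K d : ℕ} (μ : Measure Ω)
    (X : Ω → Fin K × Fin d → ℝ) (θ : Ω → Fin d → ℝ) (a : Ω → Fin K) : Prop :=
  Measurable a ∧
    ∀ᵐ ω ∂μ, ∀ i, armContext (X ω) i ⬝ᵥ θ ω ≤ armContext (X ω) (a ω) ⬝ᵥ θ ω

/-- The `(j, k)` entry of the random matrix `X_a X_aᵀ`, for the selected context `X_a`. -/
def selectedGram {Ω : Type*} {K d : ℕ} (X : Ω → Fin K × Fin d → ℝ) (a : Ω → Fin K)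
    (j k : Fin d) (ω : Ω) : ℝ :=
  armContext (X ω) (a ω) j * armContext (X ω) (a ω) k

/-- `E[X_a X_aᵀ] ⪰ lam · I_d`, the expectation being that of an integrable matrix. -/
def SecondMomentGE {Ω : Type*} [MeasurableSpace Ω] {K d : ℕ} (μ : Measure Ω)
    (X : Ω → Fin K × Fin d → ℝ) (a : Ω → Fin K) (lam : ℝ) : Prop :=
  (∀ j k, Integrable (selectedGram X a j k) μ) ∧
    ((Matrix.of fun j k => ∫ ω, selectedGram X a j k ω ∂μ)
      - lam • (1 : Matrix (Fin d) (Fin d) ℝ)).PosSemidef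

/-- `E[X_a X_aᵀ | H] ⪰ lam · I_d` almost surely, the conditional expectation being that of an
integrable matrix. -/
def CondSecondMomentGE {Ω : Type*} (H : MeasurableSpace Ω) {mΩ : MeasurableSpace Ω} {K d : ℕ}
    (μ : Measure Ω) (X : Ω → Fin K × Fin d → ℝ) (a : Ω → Fin K) (lam : ℝ) : Prop :=
  (∀ j k, Integrable (selectedGram X a j k) μ) ∧
    ∀ᵐ ω ∂μ, ((Matrix.of fun j k => (μ[selectedGram X a j k | H]) ω)
      - lam • (1 : Matrix (Fin d) (Fin d) ℝ)).PosSemidef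

/-- `θ` is an estimator determined by a history `H` that is independent of the contexts `X` of the
round, it is almost surely nonzero, and `a` is the greedy arm for it. -/
structure IsGreedyFromHistory {Ω : Type*} (H : MeasurableSpace Ω) {mΩ : MeasurableSpace Ω}
    {K d : ℕ} (μ : Measure Ω) (X : Ω → Fin K × Fin d → ℝ) (θ : Ω → Fin d → ℝ) (a : Ω → Fin K) :
    Prop where
  le : H ≤ mΩ
  indep : Indep (MeasurableSpace.comap X MeasurableSpace.pi) H μ
  measurable : Measurable[H] θ
  ne_zero : ∀ᵐ ω ∂μ, θ ω ≠ 0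
  greedy : IsGreedy μ X θ a

/-- The diversity constant of the contexts `X` of a round is at least `lam`:
for every fixed direction `θ ≠ 0` and every greedy arm `a` for it, `E[X_a X_aᵀ] ⪰ lam · I_d`; and
for every history `H` that is independent of the contexts of the round and every nonzero estimator
`θ` that is determined by the history, the greedy arm `a` for it has
`E[X_a X_aᵀ | H] ⪰ lam · I_d` almost surely. -/
def DiversityConstantGE {Ω : Type*} {mΩ : MeasurableSpace Ω} {K d : ℕ} (μ : Measure Ω)
    (X : Ω → Fin K × Fin d → ℝ) (lam : ℝ) : Prop :=
  (∀ (θ : Fin d → ℝ) (a : Ω → Fin K), θ ≠ 0 → IsGreedy μ X (fun _ => θ) a →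
      SecondMomentGE μ X a lam) ∧
  (∀ (H : MeasurableSpace Ω) (θ : Ω → Fin d → ℝ) (a : Ω → Fin K),
      IsGreedyFromHistory H μ X θ a → CondSecondMomentGE H μ X a lam)

/-! The proof is a translation argument. Fix a unit vector `u` and, replacing `u` by `-u` if needed,
assume `⟨u, θ⟩ ≥ 0`. Moving the context of the greedy arm by `2ε u` keeps that arm greedy and
carries `|⟨u, x_i⟩| < ε` into `|⟨u, x_i⟩| ≥ ε`. Along the move `log f` changes by at most `2ε ‖u‖₁ M
≤ 2ε √d M`, where `M` bounds the LAC function on the ball in play. With `ε = 1 / (√d M)` the density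
drops by a factor of at most `e²`, so up to a small tail the event `|⟨u, X_a⟩| ≥ ε` has probability
at least about `1 / (1 + e²)`. Hence `E ⟨u, X_a⟩² ≥ ε² / 10 = 1 / (10 d M²)`. This is
`one_div_ten_le_sum_spreadRegion` followed by `lintegral_greedyEnergy_ge`.

The ball has radius of order `xmax (log d + log K + 2)`: the `ψ₁` bound and Markov's inequality for
a moment of logarithmic order control all `dK` coordinates at once
(`IsUnboundedContexts.norm_tail_le`).

The bound holds for each deterministic `θ ≠ 0`. Independence and Fubini integrate it over every
event of the history (`setLIntegral_greedy_ge`), which bounds the conditional expectation of each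
quadratic form. A countable dense set of `u` gives the matrix inequality. A fixed direction is the
case of the trivial history. -/

/-! ### Shifts of one arm, greedy regions, and the density under a shift. -/

section Stacked

variable {K d : ℕ}

/-- The stacked vector whose `i`-th arm is `v` and whose other arms vanish. -/
def armShift (i : Fin K) (v : Fin d → ℝ) : Fin K × Fin d → ℝ :=
  fun p => if p.1 = i then v p.2 else 0

/-- The stacked contexts for which `i` is the unique greedy arm in the direction `θ`. -/
def greedyRegion (θ : Fin d → ℝ) (i : Fin K) : Set (Fin K × Fin d → ℝ) :=
  {x | ∀ j, j ≠ i → armContext x j ⬝ᵥ θ < armContext x i ⬝ᵥ θ}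

theorem armContext_add (x y : Fin K × Fin d → ℝ) (i : Fin K) :
    armContext (x + y) i = armContext x i + armContext y i := rfl

theorem armContext_armShift_self (i : Fin K) (v : Fin d → ℝ) :
    armContext (armShift i v) i = v := by
  ext j; simp [armContext, armShift]

theorem armContext_armShift_of_ne {i j : Fin K} (h : j ≠ i) (v : Fin d → ℝ) :
    armContext (armShift i v) j = 0 := by
  ext k; simp [armContext, armShift, h]

theorem armShift_eq_sum (i : Fin K) (v : Fin d → ℝ) :
    armShift i v = ∑ j, v j • (Pi.single (i, j) 1 : Fin K × Fin d → ℝ) := by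
  ext ⟨a, b⟩
  simp only [armShift, Finset.sum_apply, Pi.smul_apply, Pi.single_apply, Prod.mk.injEq,
    smul_eq_mul, mul_ite, mul_one, mul_zero]
  by_cases h : a = i <;> simp [h]

theorem armShift_smul (i : Fin K) (s : ℝ) (v : Fin d → ℝ) :
    armShift i (s • v) = s • armShift i v := by
  ext ⟨a, b⟩; simp [armShift]

theorem abs_le_one_of_dotProduct_self {v : Fin d → ℝ} (hv : v ⬝ᵥ v = 1) (j : Fin d) :
    |v j| ≤ 1 := by
  rw [← sq_le_one_iff_abs_le_one, ← hv, sq]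
  exact Finset.single_le_sum (f := fun j => v j * v j) (fun k _ => mul_self_nonneg (v k))
    (Finset.mem_univ j)

theorem sum_abs_le_sqrt {v : Fin d → ℝ} (hv : v ⬝ᵥ v = 1) : ∑ j, |v j| ≤ √d := by
  apply Real.le_sqrt_of_sq_le
  have h := sq_sum_le_card_mul_sum_sq (s := Finset.univ) (f := fun j => |v j|)
  have h2 : ∑ j, |v j| ^ 2 = 1 := by
    rw [← hv]; exact Finset.sum_congr rfl fun j _ => by rw [sq_abs, sq]
  rw [h2] at h
  simpa using h

theorem norm_armShift_le {v : Fin d → ℝ} (hv : v ⬝ᵥ v = 1) (i : Fin K) : ‖armShift i v‖ ≤ 1 := by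
  refine (pi_norm_le_iff_of_nonneg zero_le_one).2 fun p => ?_
  unfold armShift
  split_ifs
  · exact abs_le_one_of_dotProduct_self hv _
  · simp

theorem measurable_dotProduct_armContext (u : Fin d → ℝ) (i : Fin K) :
    Measurable fun x : Fin K × Fin d → ℝ => u ⬝ᵥ armContext x i := by
  unfold dotProduct armContext; fun_prop

theorem measurableSet_greedyRegion (θ : Fin d → ℝ) (i : Fin K) :
    MeasurableSet (greedyRegion θ i) := by
  unfold greedyRegion
  have h : ∀ i : Fin K, Measurable fun x : Fin K × Fin d → ℝ => armContext x i ⬝ᵥ θ := by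
    intro i; unfold dotProduct armContext; fun_prop
  measurability

theorem add_armShift_mem_greedyRegion {θ v : Fin d → ℝ} (hv : 0 ≤ v ⬝ᵥ θ) {i : Fin K}
    {x : Fin K × Fin d → ℝ} (hx : x ∈ greedyRegion θ i) :
    x + armShift i v ∈ greedyRegion θ i := by
  intro j hj
  rw [armContext_add, armContext_add, armContext_armShift_of_ne hj, armContext_armShift_self,
    add_zero, add_dotProduct]
  linarith [hx j hj]

/-- The tie set is a linear subspace, and it is proper because it misses the vector with `θ` in arm
`i` and zero elsewhere. -/
theorem volume_tie_eq_zero {θ : Fin d → ℝ} (hθ : θ ≠ 0) {i j : Fin K} (hij : i ≠ j) :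
    volume {x : Fin K × Fin d → ℝ | armContext x i ⬝ᵥ θ = armContext x j ⬝ᵥ θ} = 0 := by
  let S : Submodule ℝ (Fin K × Fin d → ℝ) :=
    { carrier := {x | armContext x i ⬝ᵥ θ = armContext x j ⬝ᵥ θ}
      add_mem' := by
        intro a b ha hb
        simp only [Set.mem_ofPred_eq, armContext_add, add_dotProduct] at *
        rw [ha, hb]
      zero_mem' := rfl
      smul_mem' := by
        intro c x hx
        have h : ∀ i, armContext (c • x) i = c • armContext x i := fun _ => rfl
        simp only [Set.mem_ofPred_eq, h, smul_dotProduct] at *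
        rw [hx] }
  refine Measure.addHaar_submodule volume S fun h => hθ ?_
  have h1 : armShift i θ ∈ S := h ▸ Submodule.mem_top
  have h2 : armContext (armShift i θ) i ⬝ᵥ θ = armContext (armShift i θ) j ⬝ᵥ θ := h1
  rw [armContext_armShift_self, armContext_armShift_of_ne hij.symm, zero_dotProduct] at h2
  exact dotProduct_self_eq_zero.1 h2

theorem ae_exists_mem_greedyRegion [NeZero K] {θ : Fin d → ℝ} (hθ : θ ≠ 0) :
    ∀ᵐ x : Fin K × Fin d → ℝ, ∃ i, x ∈ greedyRegion θ i := by
  have h : ∀ᵐ x : Fin K × Fin d → ℝ, ∀ i j : Fin K, i ≠ j →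
      armContext x i ⬝ᵥ θ ≠ armContext x j ⬝ᵥ θ := by
    refine ae_all_iff.2 fun i => ae_all_iff.2 fun j => ?_
    by_cases hij : i = j
    · simp [hij]
    · simpa [ae_iff, hij] using volume_tie_eq_zero hθ hij
  filter_upwards [h] with x hx
  obtain ⟨i, hi⟩ := Finite.exists_max fun i : Fin K => armContext x i ⬝ᵥ θ
  exact ⟨i, fun j hj => lt_of_le_of_ne (hi j) (hx j i hj)⟩

theorem IsLAC.continuous {ι : Type*} [Fintype ι] [DecidableEq ι] {f : (ι → ℝ) → ℝ} {L : ℝ → ℝ}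
    (hf : IsLAC f L) : Continuous f := by
  have h : Continuous fun y => Real.log (f y) :=
    continuous_iff_continuousAt.2 fun x => (hf.diff x).continuousAt
  exact (Real.continuous_exp.comp h).congr fun x => Real.exp_log (hf.pos x)

/-- Mean value inequality for `log f` on a segment inside the ball of radius `R`. The sup-norm
gradient bound pairs with `‖u‖₁ ≤ √d`, the source of the factor `1 / d` in the final constant. -/
theorem IsLAC.le_exp_mul_add_armShift {f : (Fin K × Fin d → ℝ) → ℝ} {L : ℝ → ℝ}
    (hf : IsLAC f L) {M R s : ℝ} (hR : 0 ≤ R) (hM : L R ≤ M) {u : Fin d → ℝ} (hu : u ⬝ᵥ u = 1)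
    (i : Fin K) (hs : 0 ≤ s) {x : Fin K × Fin d → ℝ} (hx : ‖x‖ + s ≤ R) :
    f x ≤ Real.exp (s * (√d * M)) * f (x + armShift i (s • u)) := by
  set w : Fin K × Fin d → ℝ := armShift i u with hw
  set g : ℝ → ℝ := fun t => Real.log (f (x + t • w)) with hg
  set g' : ℝ → ℝ := fun t => fderiv ℝ (fun y => Real.log (f y)) (x + t • w) w with hg'
  have hderiv : ∀ t, HasDerivAt g (g' t) t := fun t => by
    have h1 : HasDerivAt (fun t : ℝ => x + t • w) w t := by
      simpa using ((hasDerivAt_id t).smul_const w).const_add x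
    exact (hf.diff (x + t • w)).hasFDerivAt.comp_hasDerivAt t h1
  have hbound : ∀ t ∈ Set.Ico 0 s, ‖g' t‖ ≤ √d * M := by
    intro t ht
    have hnorm : ‖x + t • w‖ ≤ R := by
      calc ‖x + t • w‖ ≤ ‖x‖ + ‖t • w‖ := norm_add_le _ _
        _ = ‖x‖ + t * ‖w‖ := by rw [norm_smul, Real.norm_of_nonneg ht.1]
        _ ≤ ‖x‖ + t * 1 := by gcongr; exacts [ht.1, norm_armShift_le hu i]
        _ ≤ R := by linarith [ht.2]
    have hLM : L ‖x + t • w‖ ≤ M := (hf.mono (norm_nonneg _) hR hnorm).trans hM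
    have hM0 : ∀ j : Fin d, |fderiv ℝ (fun y => Real.log (f y)) (x + t • w) (Pi.single (i, j) 1)|
        ≤ M := fun j => (hf.bound _ (i, j)).trans hLM
    calc ‖g' t‖ = |∑ j, u j * fderiv ℝ (fun y => Real.log (f y)) (x + t • w)
            (Pi.single (i, j) 1)| := by
          simp only [hg', Real.norm_eq_abs]
          congr 1
          conv_lhs => rw [show (fderiv ℝ (fun y => Real.log (f y)) (x + t • w)) w =
            (fderiv ℝ (fun y => Real.log (f y)) (x + t • w)) (∑ j, u j • Pi.single (i, j) 1) by
              rw [← armShift_eq_sum]]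
          simp
      _ ≤ ∑ j, |u j| * M := by
          refine (Finset.abs_sum_le_sum_abs _ _).trans (Finset.sum_le_sum fun j _ => ?_)
          rw [abs_mul]
          exact mul_le_mul_of_nonneg_left (hM0 j) (abs_nonneg _)
      _ = (∑ j, |u j|) * M := by rw [Finset.sum_mul]
      _ ≤ √d * M := by
          -- `M ≥ 0` is not assumed; it follows from the gradient bound once there is a coordinate,
          -- and `d = 0` admits no unit vector.
          rcases Nat.eq_zero_or_pos d with rfl | hd
          · simp at hu
          · exact mul_le_mul_of_nonneg_right (sum_abs_le_sqrt hu)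
              ((abs_nonneg _).trans (hM0 ⟨0, hd⟩))
  have key := norm_image_sub_le_of_norm_deriv_le_segment' (f := g) (f' := g') (a := 0) (b := s)
    (fun t _ => (hderiv t).hasDerivWithinAt) hbound s ⟨hs, le_rfl⟩
  have h0 : g 0 = Real.log (f x) := by simp [hg]
  have h1 : g s = Real.log (f (x + armShift i (s • u))) := by simp [hg, hw, armShift_smul]
  rw [h0, h1, Real.norm_eq_abs] at key
  rw [← Real.exp_log (hf.pos x), ← Real.exp_log (hf.pos (x + armShift i (s • u))), ← Real.exp_add]
  apply Real.exp_le_exp.2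
  linarith [(abs_le.1 key).1]

/-- The pointwise comparison, integrated using translation invariance of Lebesgue measure. -/
theorem setLIntegral_density_le_shift {f : (Fin K × Fin d → ℝ) → ℝ} {L : ℝ → ℝ}
    (hf : IsLAC f L) {M R s : ℝ} (hR : 0 ≤ R) (hM : L R ≤ M) {u : Fin d → ℝ} (hu : u ⬝ᵥ u = 1)
    (i : Fin K) (hs : 0 ≤ s) {A C : Set (Fin K × Fin d → ℝ)} (hA : MeasurableSet A)
    (hC : MeasurableSet C) (hAR : ∀ x ∈ A, ‖x‖ + s ≤ R)
    (hAC : ∀ x ∈ A, x + armShift i (s • u) ∈ C) :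
    (volume : Measure (Fin K × Fin d → ℝ)).withDensity (fun x => ENNReal.ofReal (f x)) A ≤
      ENNReal.ofReal (Real.exp (s * (√d * M))) *
        (volume : Measure (Fin K × Fin d → ℝ)).withDensity (fun x => ENNReal.ofReal (f x)) C := by
  have hfm : Measurable fun x => ENNReal.ofReal (f x) := hf.continuous.measurable.ennreal_ofReal
  rw [withDensity_apply _ hA, withDensity_apply _ hC, ← lintegral_indicator hA,
    ← lintegral_indicator hC,
    ← lintegral_add_right_eq_self (C.indicator _) (armShift i (s • u)),
    ← lintegral_const_mul' _ _ ENNReal.ofReal_ne_top]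
  refine lintegral_mono fun x => ?_
  by_cases hx : x ∈ A
  · rw [Set.indicator_of_mem hx, Set.indicator_of_mem (hAC x hx),
      ← ENNReal.ofReal_mul (Real.exp_nonneg _)]
    exact ENNReal.ofReal_le_ofReal
      (hf.le_exp_mul_add_armShift hR hM hu i hs (hAR x hx))
  · simp [hx]

end Stacked

/-! ### Lower bound on the greedy second moment for a fixed direction. -/

section Diversity

variable {K d : ℕ}

/-- The part of the greedy region of arm `i` where `⟨u, x_i⟩` has size at least `ε`. -/
def spreadRegion (θ u : Fin d → ℝ) (ε : ℝ) (i : Fin K) : Set (Fin K × Fin d → ℝ) :=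
  greedyRegion θ i ∩ {x | ε ≤ |u ⬝ᵥ armContext x i|}

theorem measurableSet_spreadRegion (θ u : Fin d → ℝ) (ε : ℝ) (i : Fin K) :
    MeasurableSet (spreadRegion θ u ε i) :=
  (measurableSet_greedyRegion θ i).inter
    (measurableSet_le measurable_const (measurable_dotProduct_armContext u i).abs)

theorem spreadRegion_neg (θ u : Fin d → ℝ) (ε : ℝ) (i : Fin K) :
    spreadRegion θ (-u) ε i = spreadRegion θ u ε i := by
  simp [spreadRegion]

/-- Up to ties and the tail, each point lies in some `A i` or some spread region, and the shift by
`2ε u` bounds the mass of `A i` by `e²` times that of the spread region. Since `ε ≤ R`, the shift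
stays in the ball of radius `3R`. -/
theorem one_div_ten_le_sum_spreadRegion_of_nonneg [NeZero K] {f : (Fin K × Fin d → ℝ) → ℝ}
    {L : ℝ → ℝ} (hf : IsLAC f L) {P : Measure (Fin K × Fin d → ℝ)} [IsProbabilityMeasure P]
    (hP : P = (volume : Measure (Fin K × Fin d → ℝ)).withDensity fun x => ENNReal.ofReal (f x))
    {M R ε : ℝ} (hM : L (3 * R) ≤ M) (hε : 0 < ε) (hεR : ε ≤ R) (hεM : ε * (√d * M) ≤ 1)
    {θ u : Fin d → ℝ} (hθ : θ ≠ 0) (hu : u ⬝ᵥ u = 1) (huθ : 0 ≤ u ⬝ᵥ θ)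
    (htail : P.real {x | R ≤ ‖x‖} ≤ 1 / 49) :
    1 / 10 ≤ ∑ i, P.real (spreadRegion θ u ε i) := by
  set A : Fin K → Set (Fin K × Fin d → ℝ) := fun i =>
    greedyRegion θ i ∩ {x | |u ⬝ᵥ armContext x i| < ε} ∩ {x | ‖x‖ < R} with hAdef
  have hAm : ∀ i, MeasurableSet (A i) := fun i =>
    ((measurableSet_greedyRegion θ i).inter
      (measurableSet_lt (measurable_dotProduct_armContext u i).abs measurable_const)).inter
      (measurableSet_lt measurable_norm measurable_const)
  have hAC : ∀ i, P.real (A i) ≤ Real.exp 2 * P.real (spreadRegion θ u ε i) := by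
    intro i
    have h := setLIntegral_density_le_shift hf (R := 3 * R) (s := 2 * ε) (by linarith) hM hu i
      (by linarith) (hAm i) (measurableSet_spreadRegion θ u ε i)
      (fun x hx => by have h : ‖x‖ < R := hx.2; linarith)
      (fun x hx => by
        refine ⟨add_armShift_mem_greedyRegion ?_ hx.1.1, ?_⟩
        · rw [smul_dotProduct]; exact mul_nonneg (by linarith) huθ
        · have h1 : |u ⬝ᵥ armContext x i| < ε := hx.1.2
          have h2 : u ⬝ᵥ armContext (x + armShift i ((2 * ε) • u)) i =
              u ⬝ᵥ armContext x i + 2 * ε := by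
            rw [armContext_add, armContext_armShift_self, dotProduct_add, dotProduct_smul, hu]
            simp
          simp only [Set.mem_ofPred_eq, h2]
          refine le_trans ?_ (le_abs_self _)
          linarith [(abs_lt.1 h1).1])
    rw [← hP] at h
    have h3 := ENNReal.toReal_mono (ENNReal.mul_ne_top ENNReal.ofReal_ne_top
      (measure_ne_top P _)) h
    rw [ENNReal.toReal_mul, ENNReal.toReal_ofReal (Real.exp_nonneg _)] at h3
    refine h3.trans (mul_le_mul_of_nonneg_right (Real.exp_le_exp.2 ?_) measureReal_nonneg)
    nlinarith
  have hcover : ∀ᵐ x ∂P, ∃ i, x ∈ greedyRegion θ i := by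
    rw [hP]
    exact (withDensity_absolutelyContinuous _ _).ae_le (ae_exists_mem_greedyRegion hθ)
  have hone : (1 : ℝ) ≤ P.real {x | R ≤ ‖x‖} + ∑ i, (P.real (A i) +
      P.real (spreadRegion θ u ε i)) := by
    calc (1 : ℝ) = P.real Set.univ := by simp
      _ ≤ P.real ({x | R ≤ ‖x‖} ∪ ⋃ i, (A i ∪ spreadRegion θ u ε i)) := by
          refine ENNReal.toReal_mono (measure_ne_top _ _) (measure_mono_ae ?_)
          filter_upwards [hcover] with x ⟨i, hi⟩ _
          by_cases hx : R ≤ ‖x‖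
          · exact Or.inl hx
          · refine Or.inr (Set.mem_iUnion.2 ⟨i, ?_⟩)
            rcases lt_or_ge (|u ⬝ᵥ armContext x i|) ε with h | h
            · exact Or.inl ⟨⟨hi, h⟩, not_le.1 hx⟩
            · exact Or.inr ⟨hi, h⟩
      _ ≤ _ := by
          refine (measureReal_union_le _ _).trans (add_le_add le_rfl ?_)
          refine (measureReal_iUnion_fintype_le _).trans (Finset.sum_le_sum fun i _ => ?_)
          exact measureReal_union_le _ _
  have hsum : ∑ i, (P.real (A i) + P.real (spreadRegion θ u ε i)) ≤
      (Real.exp 2 + 1) * ∑ i, P.real (spreadRegion θ u ε i) := by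
    rw [Finset.mul_sum]
    exact Finset.sum_le_sum fun i _ => by linarith [hAC i]
  -- The total spread mass is at least `(48/49) / 8.4 > 1/10`.
  have hexp : Real.exp 2 ≤ 7.4 := by
    have h : Real.exp 2 = Real.exp 1 * Real.exp 1 := by rw [← Real.exp_add]; norm_num
    nlinarith [Real.exp_one_lt_d9, Real.exp_pos 1]
  have hq : 0 ≤ ∑ i, P.real (spreadRegion θ u ε i) :=
    Finset.sum_nonneg fun i _ => measureReal_nonneg
  nlinarith

theorem one_div_ten_le_sum_spreadRegion [NeZero K] {f : (Fin K × Fin d → ℝ) → ℝ}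
    {L : ℝ → ℝ} (hf : IsLAC f L) {P : Measure (Fin K × Fin d → ℝ)} [IsProbabilityMeasure P]
    (hP : P = (volume : Measure (Fin K × Fin d → ℝ)).withDensity fun x => ENNReal.ofReal (f x))
    {M R ε : ℝ} (hM : L (3 * R) ≤ M) (hε : 0 < ε) (hεR : ε ≤ R) (hεM : ε * (√d * M) ≤ 1)
    {θ u : Fin d → ℝ} (hθ : θ ≠ 0) (hu : u ⬝ᵥ u = 1)
    (htail : P.real {x | R ≤ ‖x‖} ≤ 1 / 49) :
    1 / 10 ≤ ∑ i, P.real (spreadRegion θ u ε i) := by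
  rcases le_total 0 (u ⬝ᵥ θ) with h | h
  · exact one_div_ten_le_sum_spreadRegion_of_nonneg hf hP hM hε hεR hεM hθ hu h htail
  · simpa only [spreadRegion_neg] using
      one_div_ten_le_sum_spreadRegion_of_nonneg (u := -u) hf hP hM hε hεR hεM hθ (by simpa)
        (by rw [neg_dotProduct]; linarith) htail

/-- `⟨u, x_i⟩²` summed over the arms `i` that are the unique greedy arm (at most one). -/
noncomputable def greedyEnergy (u θ : Fin d → ℝ) (x : Fin K × Fin d → ℝ) : ℝ≥0∞ :=
  ∑ i, (greedyRegion θ i).indicator (fun x => ENNReal.ofReal ((u ⬝ᵥ armContext x i) ^ 2)) x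

theorem lintegral_greedyEnergy_ge_of_unit [NeZero K] (hd : 0 < d) {f : (Fin K × Fin d → ℝ) → ℝ}
    {L : ℝ → ℝ} (hf : IsLAC f L) {P : Measure (Fin K × Fin d → ℝ)} [IsProbabilityMeasure P]
    (hP : P = (volume : Measure (Fin K × Fin d → ℝ)).withDensity fun x => ENNReal.ofReal (f x))
    {M R : ℝ} (hR : 0 < R) (hM : L (3 * R) ≤ M) (hM0 : 0 < M)
    {θ u : Fin d → ℝ} (hθ : θ ≠ 0) (hu : u ⬝ᵥ u = 1)
    (htail : P.real {x | R ≤ ‖x‖} ≤ 1 / 49)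
    (htailu : ∀ i : Fin K, P.real {x | R ≤ |u ⬝ᵥ armContext x i|} ≤ 1 / (49 * K)) :
    ENNReal.ofReal (1 / 10 * (1 / d) * (1 / M ^ 2)) ≤ ∫⁻ x, greedyEnergy u θ x ∂P := by
  have hd' : (0 : ℝ) < √d := Real.sqrt_pos.2 (by exact_mod_cast hd)
  set ε : ℝ := 1 / (√d * M) with hεdef
  have hε : 0 < ε := by positivity
  have hεM : ε * (√d * M) = 1 := by rw [hεdef]; field_simp
  have hεR : ε ≤ R := by
    -- If `R < ε`, the previous estimate applies with `R` in place of `ε` and gives `|⟨u, x_i⟩| ≥ R`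
    -- on the greedy arm with probability at least `1/10`; the union bound over arms allows only
    -- `1/49`.
    by_contra! hcon
    have h1 := one_div_ten_le_sum_spreadRegion hf hP hM hR le_rfl
      (by rw [← hεM]; gcongr) hθ hu htail
    have h2 : ∑ i, P.real (spreadRegion θ u R i) ≤ ∑ _i : Fin K, (1 / (49 * K) : ℝ) :=
      Finset.sum_le_sum fun i _ => (measureReal_mono Set.inter_subset_right).trans (htailu i)
    have hK : (K : ℝ) ≠ 0 := by exact_mod_cast NeZero.ne K
    have h3 : ∑ _i : Fin K, (1 / (49 * K) : ℝ) = 1 / 49 := by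
      simp; field_simp
    linarith
  have hq := one_div_ten_le_sum_spreadRegion hf hP hM hε hεR hεM.le hθ hu htail
  have hε2 : ε ^ 2 = 1 / d * (1 / M ^ 2) := by
    rw [hεdef, div_pow, mul_pow, Real.sq_sqrt (Nat.cast_nonneg d)]; field_simp
  calc ENNReal.ofReal (1 / 10 * (1 / d) * (1 / M ^ 2))
      ≤ ENNReal.ofReal (ε ^ 2 * ∑ i, P.real (spreadRegion θ u ε i)) := by
        apply ENNReal.ofReal_le_ofReal
        rw [mul_assoc, ← hε2]
        nlinarith [sq_nonneg ε]
    _ = ∑ i, ENNReal.ofReal (ε ^ 2) * P (spreadRegion θ u ε i) := by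
        rw [ENNReal.ofReal_mul (sq_nonneg ε),
          ENNReal.ofReal_sum_of_nonneg fun i _ => measureReal_nonneg, Finset.mul_sum]
        simp
    _ ≤ ∑ i, ∫⁻ x, (greedyRegion θ i).indicator
          (fun x => ENNReal.ofReal ((u ⬝ᵥ armContext x i) ^ 2)) x ∂P := by
        refine Finset.sum_le_sum fun i _ => ?_
        rw [← lintegral_indicator_const (measurableSet_spreadRegion θ u ε i)]
        refine lintegral_mono fun x => ?_
        by_cases hx : x ∈ spreadRegion θ u ε i
        · rw [Set.indicator_of_mem hx, Set.indicator_of_mem hx.1]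
          apply ENNReal.ofReal_le_ofReal
          rw [← sq_abs (u ⬝ᵥ armContext x i)]
          exact pow_le_pow_left₀ hε.le hx.2 2
        · simp [hx]
    _ = ∫⁻ x, greedyEnergy u θ x ∂P := by
        unfold greedyEnergy
        rw [lintegral_finsetSum]
        exact fun i _ => (((measurable_dotProduct_armContext u i).pow_const 2).ennreal_ofReal).indicator
          (measurableSet_greedyRegion θ i)

theorem lintegral_greedyEnergy_ge [NeZero K] (hd : 0 < d) {f : (Fin K × Fin d → ℝ) → ℝ}
    {L : ℝ → ℝ} (hf : IsLAC f L) {P : Measure (Fin K × Fin d → ℝ)} [IsProbabilityMeasure P]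
    (hP : P = (volume : Measure (Fin K × Fin d → ℝ)).withDensity fun x => ENNReal.ofReal (f x))
    {M R : ℝ} (hR : 0 < R) (hM : L (3 * R) ≤ M) (hM0 : 0 < M)
    {θ : Fin d → ℝ} (hθ : θ ≠ 0)
    (htail : P.real {x | R ≤ ‖x‖} ≤ 1 / 49)
    (htailu : ∀ (u : Fin d → ℝ), u ⬝ᵥ u = 1 → ∀ i : Fin K,
      P.real {x | R ≤ |u ⬝ᵥ armContext x i|} ≤ 1 / (49 * K)) (u : Fin d → ℝ) :
    ENNReal.ofReal (1 / 10 * (1 / d) * (1 / M ^ 2) * (u ⬝ᵥ u)) ≤ ∫⁻ x, greedyEnergy u θ x ∂P := by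
  by_cases hu0 : u = 0
  · simp [hu0]
  have hpos : 0 < u ⬝ᵥ u := lt_of_le_of_ne
    (Finset.sum_nonneg fun j _ => mul_self_nonneg _) fun h => hu0 (dotProduct_self_eq_zero.1 h.symm)
  set r : ℝ := √(u ⬝ᵥ u) with hr
  have hr2 : r ^ 2 = u ⬝ᵥ u := Real.sq_sqrt hpos.le
  have hr0 : 0 < r := Real.sqrt_pos.2 hpos
  set v : Fin d → ℝ := r⁻¹ • u with hv
  have huv : u = r • v := by rw [hv, smul_smul, mul_inv_cancel₀ hr0.ne', one_smul]
  have hvv : v ⬝ᵥ v = 1 := by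
    rw [hv, smul_dotProduct, dotProduct_smul, ← hr2, smul_eq_mul, smul_eq_mul]; field_simp
  have h := lintegral_greedyEnergy_ge_of_unit hd hf hP hR hM hM0 hθ hvv htail (htailu v hvv)
  have hscale : ∀ x : Fin K × Fin d → ℝ,
      greedyEnergy u θ x = ENNReal.ofReal (r ^ 2) * greedyEnergy v θ x := by
    intro x
    unfold greedyEnergy
    rw [Finset.mul_sum]
    refine Finset.sum_congr rfl fun i _ => ?_
    by_cases hx : x ∈ greedyRegion θ i
    · rw [Set.indicator_of_mem hx, Set.indicator_of_mem hx, ← ENNReal.ofReal_mul (sq_nonneg r),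
        ← mul_pow]
      conv_lhs => rw [huv, smul_dotProduct, smul_eq_mul]
    · simp [hx]
  simp_rw [hscale]
  rw [lintegral_const_mul' _ _ ENNReal.ofReal_ne_top, ← hr2, mul_comm,
    ENNReal.ofReal_mul (sq_nonneg r)]
  gcongr

end Diversity

/-! ### Moments and tails from the `ψ₁` norm. -/

section Moments

variable {Ω : Type*} [MeasurableSpace Ω] {μ : Measure Ω}

theorem lintegral_rpow_le_of_psiOneNorm_le {Y : Ω → ℝ} {c p : ℝ} (hc : 0 < c)
    (h : psiOneNorm μ Y ≤ ENNReal.ofReal c) (hp : 1 ≤ p) :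
    ∫⁻ ω, ENNReal.ofReal (|Y ω| ^ p) ∂μ ≤ ENNReal.ofReal ((p * c) ^ p) := by
  have hp0 : 0 < p := by linarith
  have h1 : ENNReal.ofReal p⁻¹ * (∫⁻ ω, ENNReal.ofReal (|Y ω| ^ p) ∂μ) ^ (1 / p) ≤
      ENNReal.ofReal c :=
    (le_iSup₂ (f := fun (p : ℝ) (_ : 1 ≤ p) =>
      ENNReal.ofReal p⁻¹ * (∫⁻ ω, ENNReal.ofReal (|Y ω| ^ p) ∂μ) ^ (1 / p)) p hp).trans h
  have h2 : (∫⁻ ω, ENNReal.ofReal (|Y ω| ^ p) ∂μ) ^ (1 / p) ≤ ENNReal.ofReal (p * c) := by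
    have h3 := mul_le_mul_right h1 (ENNReal.ofReal p)
    rwa [← mul_assoc, ← ENNReal.ofReal_mul hp0.le, mul_inv_cancel₀ hp0.ne', ENNReal.ofReal_one,
      one_mul, ← ENNReal.ofReal_mul hp0.le] at h3
  have h4 := ENNReal.rpow_le_rpow h2 hp0.le
  rwa [← ENNReal.rpow_mul, one_div, inv_mul_cancel₀ hp0.ne', ENNReal.rpow_one,
    ENNReal.ofReal_rpow_of_pos (by positivity)] at h4

/-- Markov's inequality for the `p`-th moment, which is at most `(p c)^p`, at a threshold ten times
larger than `p c`. -/
theorem measureReal_tail_le_of_psiOneNorm_le [IsFiniteMeasure μ] {Y : Ω → ℝ} (hY : Measurable Y)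
    {c p : ℝ} (hc : 0 < c) (h : psiOneNorm μ Y ≤ ENNReal.ofReal c) (hp : 1 ≤ p) :
    μ.real {ω | 10 * c * p ≤ |Y ω|} ≤ (1 / 10) ^ p := by
  have hp0 : 0 < p := by linarith
  have h1 := lintegral_rpow_le_of_psiOneNorm_le hc h hp
  have h2 := mul_meas_ge_le_lintegral (μ := μ) (f := fun ω => ENNReal.ofReal (|Y ω| ^ p))
    ((hY.abs.pow_const p).ennreal_ofReal) (ENNReal.ofReal ((10 * c * p) ^ p))
  have h3 : μ {ω | 10 * c * p ≤ |Y ω|} ≤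
      μ {ω | ENNReal.ofReal ((10 * c * p) ^ p) ≤ ENNReal.ofReal (|Y ω| ^ p)} :=
    measure_mono fun ω hω =>
      ENNReal.ofReal_le_ofReal (Real.rpow_le_rpow (by positivity) hω hp0.le)
  have h4 : ENNReal.ofReal ((10 * c * p) ^ p) * μ {ω | 10 * c * p ≤ |Y ω|} ≤
      ENNReal.ofReal ((p * c) ^ p) := (mul_le_mul_right h3 _).trans (h2.trans h1)
  have h5 := ENNReal.toReal_mono ENNReal.ofReal_ne_top h4
  rw [ENNReal.toReal_mul, ENNReal.toReal_ofReal (by positivity),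
    ENNReal.toReal_ofReal (by positivity)] at h5
  have h6 : (p * c) ^ p = (10 * c * p) ^ p * (1 / 10) ^ p := by
    rw [← Real.mul_rpow (by positivity) (by norm_num)]; congr 1; ring
  rw [h6] at h5
  exact le_of_mul_le_mul_left h5 (by positivity)

theorem memLp_two_of_psiOneNorm_le {Y : Ω → ℝ} (hY : Measurable Y) {c : ℝ} (hc : 0 < c)
    (h : psiOneNorm μ Y ≤ ENNReal.ofReal c) : MemLp Y 2 μ := by
  rw [memLp_two_iff_integrable_sq hY.aestronglyMeasurable]
  refine ⟨(hY.pow_const 2).aestronglyMeasurable, ?_⟩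
  rw [hasFiniteIntegral_iff_ofReal (ae_of_all _ fun ω => sq_nonneg _)]
  have h1 := lintegral_rpow_le_of_psiOneNorm_le hc h (p := 2) (by norm_num)
  refine lt_of_le_of_lt ?_ (h1.trans_lt ENNReal.ofReal_lt_top)
  exact lintegral_mono fun ω => by simp

end Moments

/-- Since `log 10 ≥ 2`, the left side is at most `e⁻⁴ / (K d)`, and `e⁴ ≥ 49`. -/
theorem ten_inv_rpow_log_le {d K : ℕ} (hd : 1 ≤ d) (hK : 1 ≤ K) :
    (1 / 10 : ℝ) ^ (Real.log d + Real.log K + 2) ≤ 1 / (49 * (K * d)) := by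
  have hd' : (1 : ℝ) ≤ d := by exact_mod_cast hd
  have hK' : (1 : ℝ) ≤ K := by exact_mod_cast hK
  have h1 := Real.log_nonneg hd'
  have h2 := Real.log_nonneg hK'
  have he : Real.exp 2 = Real.exp 1 * Real.exp 1 := by rw [← Real.exp_add]; norm_num
  have he2 : Real.exp 2 ≤ 10 := by nlinarith [Real.exp_one_lt_d9, Real.exp_pos 1]
  have he4 : 49 ≤ Real.exp 4 := by
    have h7 : 7 ≤ Real.exp 2 := by nlinarith [Real.exp_one_gt_d9]
    have : Real.exp 4 = Real.exp 2 * Real.exp 2 := by rw [← Real.exp_add]; norm_num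
    nlinarith
  have hlog : 2 ≤ Real.log 10 := (Real.le_log_iff_exp_le (by norm_num)).2 he2
  calc (1 / 10 : ℝ) ^ (Real.log d + Real.log K + 2)
      = Real.exp (-(Real.log 10) * (Real.log d + Real.log K + 2)) := by
        rw [Real.rpow_def_of_pos (by norm_num), one_div, Real.log_inv]
    _ ≤ Real.exp (-(4 + Real.log K + Real.log d)) := Real.exp_le_exp.2 (by nlinarith)
    _ = 1 / (Real.exp 4 * (K * d)) := by
        rw [Real.exp_neg, Real.exp_add, Real.exp_add, Real.exp_log (by linarith),
          Real.exp_log (by linarith), one_div, mul_assoc]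
    _ ≤ 1 / (49 * (K * d)) := by gcongr

/-! ### Tails of the contexts, conditioning on the history, and the matrix inequality. -/

section Contexts

variable {Ω : Type*} {H : MeasurableSpace Ω} {mΩ : MeasurableSpace Ω} {K d : ℕ} {μ : Measure Ω}
  {X : Ω → Fin K × Fin d → ℝ} {L : ℝ → ℝ} {xmax : ℝ}

theorem measurable_dotProduct_context (hX : Measurable X) (u : Fin d → ℝ) (i : Fin K) :
    Measurable fun ω => u ⬝ᵥ armContext (X ω) i :=
  (measurable_dotProduct_armContext u i).comp hX

theorem IsUnboundedContexts.psiOneNorm_le (h : IsUnboundedContexts μ X L xmax) {u : Fin d → ℝ}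
    (hu : u ⬝ᵥ u = 1) (i : Fin K) :
    psiOneNorm μ (fun ω => u ⬝ᵥ armContext (X ω) i) ≤ ENNReal.ofReal xmax :=
  (le_iSup₂ (f := fun (u : Fin d → ℝ) (_ : u ⬝ᵥ u = 1) =>
    psiOneNorm μ (fun ω => u ⬝ᵥ armContext (X ω) i)) u hu).trans (h.psi_le i)

theorem IsUnboundedContexts.tail_le [IsProbabilityMeasure μ] (h : IsUnboundedContexts μ X L xmax)
    (hx : 0 < xmax) (hd : 1 ≤ d) (hK : 1 ≤ K) {u : Fin d → ℝ} (hu : u ⬝ᵥ u = 1) (i : Fin K) :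
    (μ.map X).real {x | 10 * xmax * (Real.log d + Real.log K + 2) ≤ |u ⬝ᵥ armContext x i|} ≤
      1 / (49 * (K * d)) := by
  rw [map_measureReal_apply h.measurable
    (measurableSet_le measurable_const (measurable_dotProduct_armContext u i).abs)]
  have h1 := Real.log_nonneg (show (1 : ℝ) ≤ d by exact_mod_cast hd)
  have h2 := Real.log_nonneg (show (1 : ℝ) ≤ K by exact_mod_cast hK)
  exact (measureReal_tail_le_of_psiOneNorm_le (measurable_dotProduct_context h.measurable u i) hx
    (h.psiOneNorm_le hu i) (by linarith)).trans (ten_inv_rpow_log_le hd hK)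

theorem single_dotProduct_armContext (x : Fin K × Fin d → ℝ) (i : Fin K) (j : Fin d) :
    (Pi.single j 1 : Fin d → ℝ) ⬝ᵥ armContext x i = x (i, j) := by
  simp [armContext]

/-- A large sup norm forces a large coordinate, and coordinates are pairings with unit vectors; the
union bound over the `K d` of them uses up the factor `1 / (K d)`. -/
theorem IsUnboundedContexts.norm_tail_le [IsProbabilityMeasure μ]
    (h : IsUnboundedContexts μ X L xmax) (hx : 0 < xmax) (hd : 1 ≤ d) (hK : 1 ≤ K) :
    (μ.map X).real {x | 10 * xmax * (Real.log d + Real.log K + 2) ≤ ‖x‖} ≤ 1 / 49 := by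
  have h1 := Real.log_nonneg (show (1 : ℝ) ≤ d by exact_mod_cast hd)
  have h2 := Real.log_nonneg (show (1 : ℝ) ≤ K by exact_mod_cast hK)
  have hprob : IsProbabilityMeasure (μ.map X) :=
    Measure.isProbabilityMeasure_map h.measurable.aemeasurable
  set R : ℝ := 10 * xmax * (Real.log d + Real.log K + 2) with hR
  have hR0 : 0 < R := by positivity
  have hsub : {x : Fin K × Fin d → ℝ | R ≤ ‖x‖} ⊆ ⋃ p : Fin K × Fin d,
      {x | R ≤ |(Pi.single p.2 1 : Fin d → ℝ) ⬝ᵥ armContext x p.1|} := by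
    intro x hx
    by_contra hcon
    simp only [Set.mem_iUnion, Set.mem_ofPred_eq, single_dotProduct_armContext, not_exists,
      not_le] at hcon
    exact absurd ((pi_norm_lt_iff hR0).2 hcon) (not_lt.2 hx)
  calc _ ≤ _ := measureReal_mono hsub
    _ ≤ ∑ p : Fin K × Fin d, (1 / (49 * (K * d)) : ℝ) := by
        refine (measureReal_iUnion_fintype_le _).trans (Finset.sum_le_sum fun p _ => ?_)
        exact h.tail_le hx hd hK (by simp) p.1
    _ = 1 / 49 := by
        have hd' : (d : ℝ) ≠ 0 := by positivity
        have hK' : (K : ℝ) ≠ 0 := by positivity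
        simp
        field_simp

theorem IsUnboundedContexts.lintegral_greedyEnergy_ge [IsProbabilityMeasure μ]
    (h : IsUnboundedContexts μ X L xmax) (hx : 0 < xmax) (hd : 1 ≤ d) (hK : 1 ≤ K) {M : ℝ}
    (hM0 : 0 < M) (hM : L (30 * xmax * (Real.log d + Real.log K + 2)) ≤ M) {θ : Fin d → ℝ}
    (hθ : θ ≠ 0) (u : Fin d → ℝ) :
    ENNReal.ofReal (1 / 10 * (1 / d) * (1 / M ^ 2) * (u ⬝ᵥ u)) ≤
      ∫⁻ x, greedyEnergy u θ x ∂(μ.map X) := by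
  have h1 := Real.log_nonneg (show (1 : ℝ) ≤ d by exact_mod_cast hd)
  have h2 := Real.log_nonneg (show (1 : ℝ) ≤ K by exact_mod_cast hK)
  have hprob : IsProbabilityMeasure (μ.map X) :=
    Measure.isProbabilityMeasure_map h.measurable.aemeasurable
  have : NeZero K := ⟨by omega⟩
  obtain ⟨f, hf, hfX⟩ := h.density
  refine _root_.lintegral_greedyEnergy_ge (R := 10 * xmax * (Real.log d + Real.log K + 2)) hd hf hfX
    (by positivity) (le_of_eq_of_le (by congr 1; ring) hM) hM0 hθ (h.norm_tail_le hx hd hK)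
    (fun u hu i => (h.tail_le hx hd hK hu i).trans ?_) u
  have hd' : (1 : ℝ) ≤ d := by exact_mod_cast hd
  have hK' : (1 : ℝ) ≤ K := by exact_mod_cast hK
  gcongr
  nlinarith

theorem integrable_selectedGram [IsProbabilityMeasure μ]
    (h : IsUnboundedContexts μ X L xmax) (hx : 0 < xmax) {a : Ω → Fin K} (ha : Measurable a)
    (j k : Fin d) : Integrable (selectedGram X a j k) μ := by
  have hL : ∀ i j, MemLp (fun ω => X ω (i, j)) 2 μ := fun i j => by
    have hu : (Pi.single j 1 : Fin d → ℝ) ⬝ᵥ Pi.single j 1 = 1 := by simp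
    simpa only [single_dotProduct_armContext] using memLp_two_of_psiOneNorm_le
      (measurable_dotProduct_context h.measurable _ i) hx (h.psiOneNorm_le hu i)
  have heq : selectedGram X a j k =
      fun ω => ∑ i, (a ⁻¹' {i}).indicator (fun ω => X ω (i, j) * X ω (i, k)) ω := by
    ext ω
    rw [Finset.sum_eq_single (a ω)]
    · simp [selectedGram, armContext]
    · intro i _ hi
      exact Set.indicator_of_notMem (fun h => hi h.symm) _
    · simp
  rw [heq]
  exact integrable_finsetSum _ fun i _ =>
    ((hL i j).integrable_mul (hL i k)).indicator (ha (measurableSet_singleton i))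

theorem Measurable.greedyEnergy {β : Type*} [MeasurableSpace β] {x : β → Fin K × Fin d → ℝ}
    {θ : β → Fin d → ℝ} (hx : Measurable x) (hθ : Measurable θ) (u : Fin d → ℝ) :
    Measurable fun b => greedyEnergy u (θ b) (x b) := by
  unfold _root_.greedyEnergy
  refine Finset.measurable_sum _ fun i _ => ?_
  have hm : ∀ i : Fin K, Measurable fun b => armContext (x b) i ⬝ᵥ θ b := by
    intro i; unfold dotProduct armContext; fun_prop
  have hs : MeasurableSet {b | x b ∈ greedyRegion (θ b) i} := by
    unfold greedyRegion
    simp only [Set.mem_ofPred_eq]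
    measurability
  have hg : Measurable fun b => ENNReal.ofReal ((u ⬝ᵥ armContext (x b) i) ^ 2) :=
    ((measurable_dotProduct_context hx u i).pow_const 2).ennreal_ofReal
  exact hg.indicator hs

/-- A unique greedy arm must equal any maximizer `a`. So `greedyEnergy`, a measurable function of
`(x, θ)` alone, can replace the selected arm, which may depend on further randomness. -/
theorem greedyEnergy_le {u θ : Fin d → ℝ} {x : Fin K × Fin d → ℝ} {a : Fin K}
    (ha : ∀ i, armContext x i ⬝ᵥ θ ≤ armContext x a ⬝ᵥ θ) :
    greedyEnergy u θ x ≤ ENNReal.ofReal ((u ⬝ᵥ armContext x a) ^ 2) := by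
  unfold greedyEnergy
  rw [Finset.sum_eq_single a]
  · exact Set.indicator_le_self _ _ _
  · intro i _ hi
    exact Set.indicator_of_notMem 
      (fun hx : x ∈ greedyRegion θ i => absurd (hx a hi.symm) (not_lt.2 (ha i))) _
  · simp

theorem setLIntegral_greedy_ge [IsProbabilityMeasure μ]
    {θ : Ω → Fin d → ℝ} {a : Ω → Fin K} (hX : Measurable X)
    (hg : IsGreedyFromHistory H μ X θ a) {u : Fin d → ℝ} {c : ℝ≥0∞}
    (hc : ∀ θ : Fin d → ℝ, θ ≠ 0 → c ≤ ∫⁻ x, greedyEnergy u θ x ∂(μ.map X))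
    {B : Set Ω} (hB : MeasurableSet[H] B) :
    c * μ B ≤ ∫⁻ ω in B, ENNReal.ofReal ((u ⬝ᵥ armContext (X ω) (a ω)) ^ 2) ∂μ := by
  have hBm : MeasurableSet B := hg.le _ hB
  -- Pairing the estimator with the indicator of `B` gives one `H`-measurable variable independent
  -- of `X`, so the joint law is a product and Fubini freezes `θ`.
  set Z : Ω → (Fin d → ℝ) × ℝ≥0∞ := fun ω => (θ ω, B.indicator 1 ω) with hZdef
  have hZH : Measurable[H] Z :=
    hg.measurable.prodMk ((@measurable_const _ _ _ H 1).indicator hB)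
  have hZ : Measurable Z := hZH.mono hg.le le_rfl
  have hprobX : IsProbabilityMeasure (μ.map X) :=
    Measure.isProbabilityMeasure_map hX.aemeasurable
  have hprobZ : IsProbabilityMeasure (μ.map Z) :=
    Measure.isProbabilityMeasure_map hZ.aemeasurable
  have hXZ : IndepFun X Z μ := by
    rw [IndepFun_iff_Indep]
    exact indep_of_indep_of_le_right hg.indep hZH.comap_le
  have hprod := (indepFun_iff_map_prod_eq_prod_map_map hX.aemeasurable hZ.aemeasurable).1 hXZ
  have hφ : Measurable fun q : (Fin K × Fin d → ℝ) × ((Fin d → ℝ) × ℝ≥0∞) =>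
      q.2.2 * greedyEnergy u q.2.1 q.1 :=
    Measurable.mul (by fun_prop) (Measurable.greedyEnergy (by fun_prop) (by fun_prop) u)
  have hne : ∀ᵐ z ∂(μ.map Z), z.1 ≠ 0 := by
    have hs : MeasurableSet {z : (Fin d → ℝ) × ℝ≥0∞ | z.1 ≠ 0} :=
      measurable_fst (measurableSet_singleton (0 : Fin d → ℝ)).compl
    rw [ae_map_iff hZ.aemeasurable hs]
    exact hg.ne_zero
  calc c * μ B = ∫⁻ ω, c * (Z ω).2 ∂μ := by
        rw [lintegral_const_mul _ hZ.snd]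
        simp only [hZdef]
        rw [lintegral_indicator_one hBm]
    _ = ∫⁻ z, c * z.2 ∂(μ.map Z) := (lintegral_map (measurable_snd.const_mul c) hZ).symm
    _ ≤ ∫⁻ z, ∫⁻ x, z.2 * greedyEnergy u z.1 x ∂(μ.map X) ∂(μ.map Z) := by
        refine lintegral_mono_ae ?_
        filter_upwards [hne] with z hz
        rw [lintegral_const_mul _ (Measurable.greedyEnergy measurable_id' measurable_const u), mul_comm]
        gcongr
        exact hc z.1 hz
    _ = ∫⁻ q, q.2.2 * greedyEnergy u q.2.1 q.1 ∂((μ.map X).prod (μ.map Z)) :=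
        (lintegral_prod_symm' _ hφ).symm
    _ = ∫⁻ ω, (Z ω).2 * greedyEnergy u (θ ω) (X ω) ∂μ := by
        rw [← hprod, lintegral_map hφ (hX.prodMk hZ)]
    _ ≤ ∫⁻ ω, B.indicator (fun ω => ENNReal.ofReal ((u ⬝ᵥ armContext (X ω) (a ω)) ^ 2)) ω ∂μ := by
        refine lintegral_mono_ae ?_
        filter_upwards [hg.greedy.2] with ω hω
        by_cases hωB : ω ∈ B
        · simpa [hZdef, hωB] using greedyEnergy_le hω
        · simp [hZdef, hωB]
    _ = _ := lintegral_indicator hBm _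

theorem dotProduct_sq_eq_sum_selectedGram (X : Ω → Fin K × Fin d → ℝ) (a : Ω → Fin K)
    (u : Fin d → ℝ) (ω : Ω) :
    (u ⬝ᵥ armContext (X ω) (a ω)) ^ 2 =
      ∑ j, ∑ k, (u j * u k) * selectedGram X a j k ω := by
  simp only [dotProduct, sq, Finset.sum_mul_sum, selectedGram]
  exact Finset.sum_congr rfl fun j _ => Finset.sum_congr rfl fun k _ => by ring

theorem condExp_quadratic_form [IsProbabilityMeasure μ]
    {G : Fin d → Fin d → Ω → ℝ} (hG : ∀ j k, Integrable (G j k) μ) (u : Fin d → ℝ) :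
    (μ[fun ω => ∑ j, ∑ k, (u j * u k) * G j k ω | H]) =ᵐ[μ]
      fun ω => ∑ j, ∑ k, (u j * u k) * (μ[G j k | H]) ω := by
  have h0 : (fun ω => ∑ j, ∑ k, (u j * u k) * G j k ω) =
      ∑ j, ∑ k, (u j * u k) • G j k := by
    ext ω; simp
  have hint : ∀ j k, Integrable ((u j * u k) • G j k) μ := fun j k => (hG j k).smul _
  rw [h0]
  have h1 := condExp_finsetSum (s := Finset.univ) (f := fun j => ∑ k, (u j * u k) • G j k)
    (fun j _ => integrable_finsetSum' _ fun k _ => hint j k) H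
  have h2 : ∀ᵐ ω ∂μ, ∀ j, (μ[∑ k, (u j * u k) • G j k | H]) ω =
      (∑ k, μ[(u j * u k) • G j k | H]) ω := ae_all_iff.2 fun j =>
    condExp_finsetSum (s := Finset.univ) (f := fun k => (u j * u k) • G j k)
      (fun k _ => hint j k) H
  have h3 : ∀ᵐ ω ∂μ, ∀ j k, (μ[(u j * u k) • G j k | H]) ω = (u j * u k) * (μ[G j k | H]) ω :=
    ae_all_iff.2 fun j => ae_all_iff.2 fun k => condExp_smul (u j * u k) (G j k) H
  filter_upwards [h1, h2, h3] with ω h1 h2 h3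
  rw [h1, Finset.sum_apply]
  refine Finset.sum_congr rfl fun j _ => ?_
  rw [h2, Finset.sum_apply]
  exact Finset.sum_congr rfl fun k _ => h3 j k

theorem const_le_condExp_of_forall_setIntegral (hH : H ≤ mΩ)
    [IsProbabilityMeasure μ] {Q : Ω → ℝ} (hQ : Integrable Q μ) {c : ℝ}
    (h : ∀ B, MeasurableSet[H] B → c * μ.real B ≤ ∫ ω in B, Q ω ∂μ) :
    ∀ᵐ ω ∂μ, c ≤ (μ[Q | H]) ω := by
  refine ae_of_ae_trim hH ?_
  have hprob : IsProbabilityMeasure (μ.trim hH) :=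
    ⟨by rw [trim_measurableSet_eq hH MeasurableSet.univ]; exact measure_univ⟩
  refine @ae_le_of_forall_setIntegral_le Ω H (μ.trim hH) (fun _ => c) (μ[Q | H])
    (integrable_const c) (integrable_condExp.trim hH stronglyMeasurable_condExp) ?_
  intro B hB _
  rw [← setIntegral_trim hH stronglyMeasurable_condExp hB, setIntegral_condExp hH hQ hB,
    setIntegral_const, smul_eq_mul, mul_comm, measureReal_def, trim_measurableSet_eq hH hB]
  exact h B hB

/-- Both quadratic forms are continuous in `u`, so the inequality passes to the closure of `s`. -/
theorem posSemidef_sub_smul_one_of_dense {G : Matrix (Fin d) (Fin d) ℝ} (hG : G.IsSymm) {c : ℝ}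
    {s : Set (Fin d → ℝ)} (hs : Dense s)
    (h : ∀ u ∈ s, c * (u ⬝ᵥ u) ≤ ∑ j, ∑ k, (u j * u k) * G j k) :
    (G - c • (1 : Matrix (Fin d) (Fin d) ℝ)).PosSemidef := by
  refine Matrix.PosSemidef.of_dotProduct_mulVec_nonneg ?_ fun v => ?_
  · rw [Matrix.IsHermitian, Matrix.conjTranspose_eq_transpose_of_trivial, Matrix.transpose_sub,
      hG.eq, Matrix.transpose_smul, Matrix.transpose_one]
  · have hclosed : IsClosed {u : Fin d → ℝ | c * (u ⬝ᵥ u) ≤ ∑ j, ∑ k, (u j * u k) * G j k} := by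
      unfold dotProduct
      exact isClosed_le (by fun_prop) (by fun_prop)
    have hv : c * (v ⬝ᵥ v) ≤ ∑ j, ∑ k, (v j * v k) * G j k :=
      hclosed.closure_subset_iff.2 h (hs v)
    have hGv : v ⬝ᵥ Matrix.mulVec G v = ∑ j, ∑ k, (v j * v k) * G j k := by
      simp only [dotProduct, Matrix.mulVec, Finset.mul_sum]
      exact Finset.sum_congr rfl fun j _ => Finset.sum_congr rfl fun k _ => by ring
    rw [star_trivial, Matrix.sub_mulVec, dotProduct_sub, hGv, Matrix.smul_mulVec,
      Matrix.one_mulVec, dotProduct_smul, smul_eq_mul]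
    linarith

theorem IsUnboundedContexts.condSecondMomentGE [IsProbabilityMeasure μ]
    (h : IsUnboundedContexts μ X L xmax) (hx : 0 < xmax) (hd : 1 ≤ d) (hK : 1 ≤ K) {M : ℝ}
    (hM0 : 0 < M) (hM : L (30 * xmax * (Real.log d + Real.log K + 2)) ≤ M)
    {θ : Ω → Fin d → ℝ} {a : Ω → Fin K}
    (hg : IsGreedyFromHistory H μ X θ a) :
    CondSecondMomentGE H μ X a (1 / 10 * (1 / d) * (1 / M ^ 2)) := by
  have hint := integrable_selectedGram h hx hg.greedy.1
  refine ⟨hint, ?_⟩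
  set c : ℝ := 1 / 10 * (1 / d) * (1 / M ^ 2) with hc
  have hc0 : 0 ≤ c := by positivity
  have key : ∀ u : Fin d → ℝ, ∀ᵐ ω ∂μ, c * (u ⬝ᵥ u) ≤
      ∑ j, ∑ k, (u j * u k) * (μ[selectedGram X a j k | H]) ω := by
    intro u
    have huu : 0 ≤ u ⬝ᵥ u := Finset.sum_nonneg fun j _ => mul_self_nonneg _
    have hQ : Integrable (fun ω => ∑ j, ∑ k, (u j * u k) * selectedGram X a j k ω) μ :=
      integrable_finsetSum _ fun j _ => integrable_finsetSum _ fun k _ => (hint j k).const_mul _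
    have hle := const_le_condExp_of_forall_setIntegral (c := c * (u ⬝ᵥ u)) hg.le hQ fun B hB => by
      have h1 := setLIntegral_greedy_ge h.measurable hg
        (fun θ hθ => h.lintegral_greedyEnergy_ge hx hd hK hM0 hM hθ u) hB
      simp_rw [dotProduct_sq_eq_sum_selectedGram] at h1
      rw [← ofReal_integral_eq_lintegral_ofReal hQ.integrableOn (ae_of_all _ fun ω => by
        simp only [← dotProduct_sq_eq_sum_selectedGram]; positivity), ← hc,
        ← ofReal_measureReal, ← ENNReal.ofReal_mul (mul_nonneg hc0 huu)] at h1
      refine (ENNReal.ofReal_le_ofReal_iff (integral_nonneg fun ω => ?_)).1 h1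
      simp only [← dotProduct_sq_eq_sum_selectedGram]
      positivity
    filter_upwards [hle, condExp_quadratic_form hint u] with ω h1 h2
    rwa [h2] at h1
  -- The null set in `key` depends on `u`; countably many directions share one.
  filter_upwards [ae_all_iff.2 fun n : ℕ => key (TopologicalSpace.denseSeq (Fin d → ℝ) n)]
    with ω hω
  refine posSemidef_sub_smul_one_of_dense ?_ (TopologicalSpace.denseRange_denseSeq (Fin d → ℝ)) ?_
  · ext j k
    have hsymm : selectedGram X a k j = selectedGram X a j k := by
      ext ω; exact mul_comm _ _
    simp [hsymm]
  · rintro _ ⟨n, rfl⟩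
    exact hω n

theorem IsUnboundedContexts.diversityConstantGE [IsProbabilityMeasure μ]
    (h : IsUnboundedContexts μ X L xmax) (hx : 0 < xmax) (hd : 1 ≤ d) (hK : 1 ≤ K) {M : ℝ}
    (hM0 : 0 < M) (hM : L (30 * xmax * (Real.log d + Real.log K + 2)) ≤ M) :
    DiversityConstantGE μ X (1 / 10 * (1 / d) * (1 / M ^ 2)) := by
  refine ⟨fun θ a hθ ha => ?_, fun H θ a hg => h.condSecondMomentGE hx hd hK hM0 hM hg⟩
  have hg : IsGreedyFromHistory ⊥ μ X (fun _ => θ) a :=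
    ⟨bot_le, indep_bot_right _, measurable_const, ae_of_all _ fun _ => hθ, ha⟩
  obtain ⟨hint, hpos⟩ := h.condSecondMomentGE hx hd hK hM0 hM hg
  refine ⟨hint, ?_⟩
  simp_rw [condExp_bot] at hpos
  -- Over the trivial history the conditional expectation is constant, so the statement at one point
  -- suffices.
  exact hpos.exists.choose_spec

theorem DiversityConstantGE.mono {lam lam' : ℝ} (h : DiversityConstantGE μ X lam)
    (hle : lam' ≤ lam) : DiversityConstantGE μ X lam' := by
  have hmat : ∀ G : Matrix (Fin d) (Fin d) ℝ, (G - lam • (1 : Matrix _ _ ℝ)).PosSemidef →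
      (G - lam' • (1 : Matrix _ _ ℝ)).PosSemidef := fun G hG => by
    have h1 : ((lam - lam') • (1 : Matrix (Fin d) (Fin d) ℝ)).PosSemidef :=
      Matrix.PosSemidef.one.smul (sub_nonneg.2 hle)
    have h2 := hG.add h1
    rwa [sub_smul, sub_add_sub_cancel] at h2
  exact ⟨fun θ a hθ ha => ⟨(h.1 θ a hθ ha).1, hmat _ (h.1 θ a hθ ha).2⟩,
    fun H θ a hg => ⟨(h.2 H θ a hg).1, (h.2 H θ a hg).2.mono fun ω hω => hmat _ hω⟩⟩

theorem IsUnboundedContexts.lacFunction_nonneg [IsProbabilityMeasure μ] [NeZero K] [NeZero d]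
    (h : IsUnboundedContexts μ X L xmax) {r : ℝ} (hr : 0 ≤ r) : 0 ≤ L r := by
  obtain ⟨f, hf, -⟩ := h.density
  have h0 : 0 ≤ L 0 := (abs_nonneg _).trans (by simpa using hf.bound 0 (0, 0))
  exact h0.trans (hf.mono (Set.mem_Ici.2 le_rfl) hr hr)

end Contexts

theorem theorem2 :
    ∃ c₁ c₂ : ℝ, 0 < c₁ ∧ 0 < c₂ ∧
      ∀ A₁ A₂ α xmax : ℝ, 0 ≤ α → 0 < xmax →
        -- the explicit bound, with absolute constants
        (∀ (d K : ℕ), 1 ≤ d → 2 ≤ K →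
          ∀ (Ω : Type u) [MeasurableSpace Ω] (μ : Measure Ω) [IsProbabilityMeasure μ]
            (X : Ω → Fin K × Fin d → ℝ),
            IsUnboundedContexts μ X (fun x => A₁ + A₂ * x ^ α) xmax →
            ∀ R₁ : ℝ, R₁ = c₂ * xmax * (Real.log d + Real.log K + 2) →
              DiversityConstantGE μ X (c₁ * (1 / d) * (1 / (A₁ + A₂ * (R₁ + 2) ^ α) ^ 2))) ∧
        -- in particular: of order `1 / d` up to logarithmic factors
        (∃ c : ℝ, 0 < c ∧ ∀ (d K : ℕ), 1 ≤ d → 2 ≤ K →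
          ∀ (Ω : Type u) [MeasurableSpace Ω] (μ : Measure Ω) [IsProbabilityMeasure μ]
            (X : Ω → Fin K × Fin d → ℝ),
            IsUnboundedContexts μ X (fun x => A₁ + A₂ * x ^ α) xmax →
              DiversityConstantGE μ X
                (c * (1 / d) * (1 / (Real.log d + Real.log K + 2) ^ (2 * α)))) := by
  -- `30 = 3 · 10`: the tail threshold carries the factor `10`, and the ball that contains the
  -- shifts is three times larger.
  refine ⟨1 / 10, 30, by norm_num, by norm_num, fun A₁ A₂ α xmax hα hx => ⟨?_, ?_⟩⟩
  · rintro d K hd hK Ω _ μ _ X h R₁ rfl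
    have : NeZero K := ⟨by omega⟩
    have : NeZero d := ⟨by omega⟩
    have h1 := Real.log_nonneg (show (1 : ℝ) ≤ d by exact_mod_cast hd)
    have h2 := Real.log_nonneg (show (1 : ℝ) ≤ K by exact_mod_cast (by omega : 1 ≤ K))
    set R₁ : ℝ := 30 * xmax * (Real.log d + Real.log K + 2) with hR
    have hR0 : 0 ≤ R₁ := by positivity
    have hmono : A₁ + A₂ * R₁ ^ α ≤ A₁ + A₂ * (R₁ + 2) ^ α := by
      obtain ⟨f, hf, -⟩ := h.density
      exact hf.mono (Set.mem_Ici.2 hR0) (Set.mem_Ici.2 (by linarith)) (by linarith)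
    have hnonneg : 0 ≤ A₁ + A₂ * (R₁ + 2) ^ α :=
      h.lacFunction_nonneg (r := R₁ + 2) (by linarith)
    rcases hnonneg.lt_or_eq with hpos | hzero
    · exact h.diversityConstantGE hx hd (by omega) hpos hmono
    -- Here the claimed constant is `0`, as division by zero gives `0`; the bound with `M = 1` is
    -- stronger.
    · rw [← hzero]
      refine (h.diversityConstantGE hx hd (by omega) one_pos (by linarith)).mono ?_
      rw [zero_pow two_ne_zero, div_zero, mul_zero]
      positivity
  -- `M = C l ^ α` dominates the LAC function at `30 xmax l`, because `l ≥ 1`; the summand `1` keeps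
  -- `C` positive.
  · set C : ℝ := |A₁| + |A₂| * (30 * xmax) ^ α + 1 with hC
    have hC0 : 0 < C := by positivity
    refine ⟨1 / 10 * (1 / C ^ 2), by positivity, fun d K hd hK Ω _ μ _ X h => ?_⟩
    have h1 := Real.log_nonneg (show (1 : ℝ) ≤ d by exact_mod_cast hd)
    have h2 := Real.log_nonneg (show (1 : ℝ) ≤ K by exact_mod_cast (by omega : 1 ≤ K))
    set l : ℝ := Real.log d + Real.log K + 2 with hl
    have hl0 : 0 < l := by positivity
    have hlα : 1 ≤ l ^ α := Real.one_le_rpow (by linarith) hα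
    have hM : A₁ + A₂ * (30 * xmax * l) ^ α ≤ C * l ^ α := by
      rw [Real.mul_rpow (by positivity) hl0.le, ← mul_assoc]
      have hA₁ : A₁ ≤ |A₁| * l ^ α :=
        (le_abs_self _).trans (le_mul_of_one_le_right (abs_nonneg _) hlα)
      have hA₂ : A₂ * (30 * xmax) ^ α * l ^ α ≤ |A₂| * (30 * xmax) ^ α * l ^ α := by
        gcongr; exact le_abs_self _
      rw [hC, add_mul, add_mul]
      linarith
    refine (h.diversityConstantGE hx hd (by omega) (by positivity) hM).mono (le_of_eq ?_)
    rw [mul_pow, ← Real.rpow_mul_natCast hl0.le, Nat.cast_ofNat, mul_comm α 2]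
    field_simp
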